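/- Call a set $C\subseteq\{0,1\}^n$ a concept class. Its VC dimension $\mathrm{VC}(C)$ is the largest size of a set $I\subseteq\{1,\dots,n\}$ of coordinates such that the restriction of $C$ to $I$ is all of $\{0,1\}^I$. The class $C$ is maximal if every $C'\subseteq\{0,1\}^n$ properly containing $C$ satisfies $\mathrm{VC}(C')>\mathrm{VC}(C)$, and maximum if $|C|=\sum_{i=0}^{\mathrm{VC}(C)}\binom{n}{i}$. A $k$-cube of $\{0,1\}^n$ is a set of points obtained by letting some $k$ coordinates vary freely and fixing each of the other $n-k$ coordinates. Theorem. Let $n,d,k$ be integers with $n>1$, $0\le d\le n$ and $0\le k<n-d-1$, and let $C\subseteq\{0,1\}^n$ be a maximal concept class of VC dimension $d$. Then the number of $k$-cubes contained in the complement $\overline{C}=\{0,1\}^n\setminus C$ is at least $$\sum_{i=k}^{n-d-1}\binom{i}{k}\binom{n}{i},$$ and it is equal to this sum if and only if $C$ is maximum. -/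

import Mathlib

namespace ConceptClass

/-- The support of a concept `c ∈ {0,1}^n`: the set of coordinates where `c` takes value one. -/
def support {n : ℕ} (c : Fin n → Bool) : Finset (Fin n) :=
  Finset.univ.filter fun i => c i = true

/-- The VC dimension of a concept class `C ⊆ {0,1}^n`: the largest size of a set of coordinates
shattered by the set system of supports of the concepts of `C`. -/
def vcDim {n : ℕ} (C : Finset (Fin n → Bool)) : ℕ :=
  (C.image support).vcDim

/-- `C` is maximum: it meets the bound `|C| ≤ ∑_{i ≤ VC(C)} (n choose i)` with equality. -/
def IsMaximum {n : ℕ} (C : Finset (Fin n → Bool)) : Prop :=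
  C.card = ∑ i ∈ Finset.Icc 0 (vcDim C), n.choose i

/-- `C` is maximal: every proper extension of `C` has strictly larger VC dimension. -/
def IsMaximal {n : ℕ} (C : Finset (Fin n → Bool)) : Prop :=
  ∀ C' : Finset (Fin n → Bool), C ⊂ C' → vcDim C < vcDim C'

/-- `Q` is a `k`-cube of `{0,1}^n`: a set of `k` coordinates is free, and every other coordinate
is fixed to the value it has in some `a`. -/
def IsCube {n : ℕ} (k : ℕ) (Q : Finset (Fin n → Bool)) : Prop :=
  ∃ (I : Finset (Fin n)) (a : Fin n → Bool),
    I.card = k ∧ Q = Finset.univ.filter fun x => ∀ i, i ∉ I → x i = a i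

open Classical in
/-- The number of `k`-cubes (as sets of points) contained in `A ⊆ {0,1}^n`. -/
noncomputable def cubeCount {n : ℕ} (k : ℕ) (A : Finset (Fin n → Bool)) : ℕ :=
  (A.powerset.filter fun Q => IsCube k Q).card

end ConceptClass

/-! A `k`-cube avoiding `C` is a set `I` of `k` free coordinates together with a pattern on `Iᶜ`
that `C` misses. Sauer–Shelah on each `Iᶜ` gives the lower bound, with equality iff every trace of
`C` on `n - k` coordinates meets the Sauer bound for `d`. Such tightness passes to smaller
coordinate sets, so what remains is a local-to-global statement: a maximal class tight on all `(d +
2)`-sets is maximum (`le_card_of_indepOn`).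

This is proved by the polynomial method over 𝔽₂. A forbidden trace on a `(d + 1)`-set `S` has an
indicator with leading monomial `x_S` that vanishes on `C`. Reducing by these indicators shows that
functions of degree at most `d` realise every function on a trace; tightness means that none but
zero vanishes there (`indepOn_iff_card`). On a `(d + 2)`-set, tightness yields relations between the
indicators. These leave one generator for each `T` with `|T| > d`, while maximality puts the point
mass of every non-member in their span. Hence `|Cᶜ|` is at most the number of such `T`. -/

namespace ConceptClass

/-! ### Functions vanishing on a family -/

section Vanishing

variable {α : Type*} {𝒜 : Finset (Finset α)}

/-- The functions vanishing on `𝒜`. -/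
def vanishing (𝒜 : Finset (Finset α)) : Submodule (ZMod 2) (Finset α → ZMod 2) where
  carrier := {q | ∀ A ∈ 𝒜, q A = 0}
  add_mem' hp hq A hA := by simp [hp A hA, hq A hA]
  zero_mem' _ _ := rfl
  smul_mem' c q hq A hA := by simp [hq A hA]

theorem mul_mem_vanishing (p : Finset α → ZMod 2) {q : Finset α → ZMod 2}
    (hq : q ∈ vanishing 𝒜) : p * q ∈ vanishing 𝒜 := fun A hA => by simp [hq A hA]

end Vanishing

/-! ### Square-free polynomials over 𝔽₂ -/

section Monomials

variable {α : Type*} [DecidableEq α]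

/-- The square-free monomial `∏ i ∈ T, x i` over `𝔽₂`, as a function of the support of `x`. -/
def monomial (T Z : Finset α) : ZMod 2 := if T ⊆ Z then 1 else 0

/-- The indicator of the family of all `Z` with trace `X` on `S`. -/
def traceIndicator (S X Z : Finset α) : ZMod 2 := if Z ∩ S = X then 1 else 0

theorem monomial_mul (S T : Finset α) : monomial S * monomial T = monomial (S ∪ T) := by
  funext Z
  simp only [Pi.mul_apply, monomial, Finset.union_subset_iff]
  split_ifs <;> simp_all

theorem monomial_inter_of_subset {T M : Finset α} (h : T ⊆ M) (Z : Finset α) :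
    monomial T (Z ∩ M) = monomial T Z := by
  simp [monomial, Finset.subset_inter_iff, h]

/-- Möbius inversion on the Boolean lattice; the signs disappear in characteristic two. -/
theorem sum_Icc_monomial (S X : Finset α) :
    ∑ B ∈ Finset.Icc X S, monomial B = traceIndicator S X := by
  funext Z
  have key : (Finset.Icc X S).filter (· ⊆ Z) = Finset.Icc X (Z ∩ S) := by
    ext B
    simp only [Finset.mem_filter, Finset.mem_Icc, Finset.subset_inter_iff]
    tauto
  simp only [Finset.sum_apply, monomial, traceIndicator, Finset.sum_boole, key]
  split_ifs with hZ
  · rw [hZ]; simp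
  · by_cases hX : X ⊆ Z ∩ S
    -- The interval has `2 ^ r` elements with `r > 0`, an even number.
    · rw [Finset.card_Icc_finset hX]
      have hlt : X.card < (Z ∩ S).card :=
        Finset.card_lt_card (Finset.ssubset_iff_subset_ne.2 ⟨hX, fun e => hZ e.symm⟩)
      push_cast
      rw [show (2 : ZMod 2) = 0 from rfl, zero_pow (by omega)]
    · rw [Finset.Icc_eq_empty (by simpa using hX)]; simp

/-- The span of the monomials of degree at most `d` in the variables of `M`. -/
def lowDegree (d : ℕ) (M : Finset α) : Submodule (ZMod 2) (Finset α → ZMod 2) :=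
  Submodule.span (ZMod 2) (monomial '' {V | V ⊆ M ∧ V.card ≤ d})

theorem monomial_mem_lowDegree {d : ℕ} {V M : Finset α} (h : V ⊆ M) (hV : V.card ≤ d) :
    monomial V ∈ lowDegree d M :=
  Submodule.subset_span ⟨V, ⟨h, hV⟩, rfl⟩

theorem lowDegree_mono {d e : ℕ} {M N : Finset α} (hd : d ≤ e) (h : M ⊆ N) :
    lowDegree d M ≤ lowDegree e N :=
  Submodule.span_mono (Set.image_mono fun _ hV => ⟨hV.1.trans h, hV.2.trans hd⟩)

theorem apply_inter_of_mem_lowDegree {d : ℕ} {M : Finset α} {q : Finset α → ZMod 2}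
    (hq : q ∈ lowDegree d M) (Z : Finset α) : q (Z ∩ M) = q Z := by
  induction hq using Submodule.span_induction with
  | mem q hq =>
    obtain ⟨V, hV, rfl⟩ := hq
    exact monomial_inter_of_subset hV.1 Z
  | zero => rfl
  | add p q _ _ hp hq => simp [hp, hq]
  | smul c q _ hq => simp [hq]

/-- Multiplying a full trace indicator on `S` by a monomial in variables outside `S` yields
a single top monomial up to terms of smaller degree. -/
theorem monomial_mul_traceIndicator_sub_mem {S X T : Finset α} {d : ℕ} (hX : X ⊆ S) (hS : S ⊆ T)
    (hT : T.card = d + 1) :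
    monomial (T \ S) * traceIndicator S X - monomial T ∈ lowDegree d T := by
  have hmem : S ∈ Finset.Icc X S := by simp [hX]
  rw [← sum_Icc_monomial, Finset.mul_sum, ← Finset.add_sum_erase _ _ hmem, monomial_mul,
    Finset.sdiff_union_of_subset hS, add_sub_cancel_left]
  refine Submodule.sum_mem _ fun B hB => ?_
  rw [monomial_mul]
  simp only [Finset.mem_erase, Finset.mem_Icc] at hB
  have hlt : B.card < S.card :=
    Finset.card_lt_card (Finset.ssubset_iff_subset_ne.2 ⟨hB.2.2, hB.1⟩)
  refine monomial_mem_lowDegree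
    (Finset.union_subset Finset.sdiff_subset (hB.2.2.trans hS)) ?_
  have h1 := Finset.card_union_le (T \ S) B
  have h2 := Finset.card_sdiff_add_card_eq_card hS
  omega

theorem traceIndicator_sub_mem {S X : Finset α} {d : ℕ} (hX : X ⊆ S) (hS : S.card = d + 1) :
    traceIndicator S X - monomial S ∈ lowDegree d S := by
  have h := monomial_mul_traceIndicator_sub_mem hX subset_rfl hS
  have h1 : monomial (S \ S) = (1 : Finset α → ZMod 2) := by
    funext Z; simp [monomial]
  rwa [h1, one_mul] at h

section Fintype

variable [Fintype α]

theorem traceIndicator_univ (X : Finset α) :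
    traceIndicator Finset.univ X = Pi.single X (1 : ZMod 2) := by
  funext Z
  simp only [traceIndicator, Finset.inter_univ, Pi.single_apply]

/-- There are as many monomials as the dimension, and by inversion they span all point masses. -/
theorem linearIndependent_monomial :
    LinearIndependent (ZMod 2) (monomial : Finset α → Finset α → ZMod 2) := by
  refine linearIndependent_of_top_le_span_of_card_eq_finrank ?_ (by simp)
  rw [← (Pi.basisFun (ZMod 2) (Finset α)).span_eq, Submodule.span_le]
  rintro _ ⟨X, rfl⟩
  rw [Pi.basisFun_apply, ← traceIndicator_univ, ← sum_Icc_monomial]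
  exact Submodule.sum_mem _ fun B _ => Submodule.subset_span ⟨B, rfl⟩

theorem finrank_lowDegree (d : ℕ) (M : Finset α) :
    Module.finrank (ZMod 2) (lowDegree d M) = (M.powerset.filter (·.card ≤ d)).card := by
  have h := finrank_span_eq_card (linearIndependent_monomial.comp
    (Subtype.val : (M.powerset.filter (·.card ≤ d)) → Finset α) Subtype.val_injective)
  rw [Fintype.card_coe] at h
  have hs : Set.range (Subtype.val : (M.powerset.filter (·.card ≤ d)) → Finset α) =
      {V | V ⊆ M ∧ V.card ≤ d} := by
    ext V
    simp
  rw [← h, Set.range_comp, hs, lowDegree]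

end Fintype

end Monomials

/-! ### Sauer–Shelah bound and its equality case -/

section Sauer

variable {α : Type*} [DecidableEq α] {𝒜 : Finset (Finset α)} {d : ℕ}

/-- The number of subsets of `M` with at most `d` elements. -/
theorem card_powerset_filter_card_le (d : ℕ) (M : Finset α) :
    (M.powerset.filter (·.card ≤ d)).card = ∑ i ∈ Finset.Icc 0 d, M.card.choose i := by
  have : M.powerset.filter (·.card ≤ d) =
      (Finset.Icc 0 d).biUnion fun i => M.powersetCard i := by
    ext V
    simp [Finset.mem_powersetCard, and_comm]
  rw [this, Finset.card_biUnion]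
  · simp
  · intro i _ j _ hij
    exact Finset.pairwise_disjoint_powersetCard M hij

theorem card_le_of_shatters (hd : 𝒜.vcDim ≤ d) {S : Finset α} (h : 𝒜.Shatters S) :
    S.card ≤ d :=
  h.card_le_vcDim.trans hd

/-- The Sauer–Shelah bound for the trace of a family on `M`. -/
theorem card_image_inter_le (hd : 𝒜.vcDim ≤ d) (M : Finset α) :
    (𝒜.image (· ∩ M)).card ≤ (M.powerset.filter (·.card ≤ d)).card := by
  refine (Finset.card_le_card_shatterer _).trans (Finset.card_le_card fun S hS => ?_)
  rw [Finset.mem_shatterer] at hS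
  have hSM : S ⊆ M := by
    obtain ⟨u, hu, hSu⟩ := hS.exists_superset
    obtain ⟨A, _, rfl⟩ := Finset.mem_image.1 hu
    exact hSu.trans Finset.inter_subset_right
  refine Finset.mem_filter.2 ⟨Finset.mem_powerset.2 hSM, card_le_of_shatters hd fun t ht => ?_⟩
  obtain ⟨u, hu, hu'⟩ := hS ht
  obtain ⟨A, hA, rfl⟩ := Finset.mem_image.1 hu
  refine ⟨A, hA, ?_⟩
  rw [← hu', Finset.inter_left_comm, Finset.inter_eq_left.2 hSM, Finset.inter_comm]

theorem exists_forbidden (hd : 𝒜.vcDim ≤ d) {S : Finset α} (hS : S.card = d + 1) :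
    ∃ X ⊆ S, ∀ A ∈ 𝒜, A ∩ S ≠ X := by
  by_contra! h
  have : 𝒜.Shatters S := fun X hX => by
    obtain ⟨A, hA, h'⟩ := h X hX
    exact ⟨A, hA, by rwa [Finset.inter_comm]⟩
  have := card_le_of_shatters hd this
  omega

/-- The only function of degree at most `d` in the variables of `W` vanishing on `𝒜` is zero. -/
def IndepOn (𝒜 : Finset (Finset α)) (d : ℕ) (W : Finset α) : Prop :=
  ∀ q ∈ lowDegree d W, (∀ A ∈ 𝒜, q A = 0) → q = 0

theorem IndepOn.mono {W M : Finset α} (h : IndepOn 𝒜 d M) (hW : W ⊆ M) : IndepOn 𝒜 d W :=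
  fun q hq => h q (lowDegree_mono le_rfl hW hq)

theorem traceIndicator_mem_vanishing {S X : Finset α} (h : ∀ A ∈ 𝒜, A ∩ S ≠ X) :
    traceIndicator S X ∈ vanishing 𝒜 := fun A hA => by simp [traceIndicator, h A hA]

/-- Modulo functions vanishing on a family of VC dimension at most `d`, every monomial has
degree at most `d`. -/
theorem monomial_mem_sup (hd : 𝒜.vcDim ≤ d) {B M : Finset α} (hB : B ⊆ M) :
    monomial B ∈ lowDegree d M ⊔ vanishing 𝒜 := by
  induction hn : B.card using Nat.strong_induction_on generalizing B with
  | _ n ih =>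
    rcases Nat.lt_or_ge d n with hlt | hle
    · obtain ⟨S, hS, hSc⟩ := Finset.exists_subset_card_eq (show d + 1 ≤ B.card by omega)
      obtain ⟨X, hX, hforb⟩ := exists_forbidden hd hSc
      -- A multiple of a vanishing indicator has leading monomial `B`, so `B` reduces to degree
      -- below `n`.
      have h1 := monomial_mul_traceIndicator_sub_mem hX hS (d := n - 1) (by omega)
      have h2 : lowDegree (n - 1) B ≤ lowDegree d M ⊔ vanishing 𝒜 := by
        refine Submodule.span_le.2 ?_
        rintro _ ⟨V, ⟨hV, hVc⟩, rfl⟩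
        exact ih V.card (by omega) (hV.trans hB) rfl
      have h3 : monomial (B \ S) * traceIndicator S X ∈ lowDegree d M ⊔ vanishing 𝒜 :=
        Submodule.mem_sup_right (mul_mem_vanishing _ (traceIndicator_mem_vanishing hforb))
      simpa using Submodule.sub_mem _ h3 (h2 h1)
    · exact Submodule.mem_sup_left (monomial_mem_lowDegree hB (by omega))

/-- Restriction of the functions of degree at most `d` in the variables of `M` to the trace
of `𝒜` on `M`. -/
def restrictTrace (𝒜 : Finset (Finset α)) (d : ℕ) (M : Finset α) :
    lowDegree d M →ₗ[ZMod 2] (𝒜.image (· ∩ M) → ZMod 2) :=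
  (LinearMap.funLeft (ZMod 2) (ZMod 2) Subtype.val).comp (lowDegree d M).subtype

theorem restrictTrace_eq_zero_iff {M : Finset α} (q : lowDegree d M) :
    restrictTrace 𝒜 d M q = 0 ↔ ∀ A ∈ 𝒜, q.1 A = 0 := by
  constructor
  · intro h A hA
    have := congrFun h ⟨A ∩ M, Finset.mem_image_of_mem _ hA⟩
    rw [← apply_inter_of_mem_lowDegree q.2]
    exact this
  · rintro h
    funext ⟨Z, hZ⟩
    obtain ⟨A, hA, rfl⟩ := Finset.mem_image.1 hZ
    exact (apply_inter_of_mem_lowDegree q.2 A).trans (h A hA)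

theorem injective_restrictTrace_iff {M : Finset α} :
    Function.Injective (restrictTrace 𝒜 d M) ↔ IndepOn 𝒜 d M := by
  rw [injective_iff_map_eq_zero]
  constructor
  · intro h q hq hv
    exact congrArg Subtype.val (h ⟨q, hq⟩ ((restrictTrace_eq_zero_iff _).2 hv))
  · intro h q hq
    exact Subtype.ext (h q.1 q.2 ((restrictTrace_eq_zero_iff q).1 hq))

theorem surjective_restrictTrace (hd : 𝒜.vcDim ≤ d) (M : Finset α) :
    Function.Surjective (restrictTrace 𝒜 d M) := by
  rw [← LinearMap.range_eq_top, eq_top_iff, ← (Pi.basisFun (ZMod 2) _).span_eq,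
    Submodule.span_le]
  rintro _ ⟨⟨X, hX⟩, rfl⟩
  have hXM : X ⊆ M := by
    obtain ⟨A, _, rfl⟩ := Finset.mem_image.1 hX
    exact Finset.inter_subset_right
  have hmem : traceIndicator M X ∈ lowDegree d M ⊔ vanishing 𝒜 := by
    rw [← sum_Icc_monomial]
    exact Submodule.sum_mem _ fun B hB => monomial_mem_sup hd (Finset.mem_Icc.1 hB).2
  obtain ⟨q, hq, r, hr, hqr⟩ := Submodule.mem_sup.1 hmem
  refine ⟨⟨q, hq⟩, ?_⟩
  funext ⟨Z, hZ⟩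
  obtain ⟨A, hA, rfl⟩ := Finset.mem_image.1 hZ
  have h1 := congrFun hqr A
  rw [Pi.add_apply, hr A hA, add_zero] at h1
  refine (apply_inter_of_mem_lowDegree hq A).trans (h1.trans ?_)
  simp [traceIndicator, Pi.basisFun_apply, Pi.single_apply]

/-- A family of VC dimension at most `d` meets the Sauer–Shelah bound on `M` iff the functions of
degree at most `d` in the variables of `M` are determined by their values on it. -/
theorem indepOn_iff_card [Fintype α] (hd : 𝒜.vcDim ≤ d) (M : Finset α) :
    IndepOn 𝒜 d M ↔
      (𝒜.image (· ∩ M)).card = (M.powerset.filter (·.card ≤ d)).card := by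
  rw [← injective_restrictTrace_iff, ← finrank_lowDegree]
  constructor
  · intro h
    have := (LinearEquiv.ofBijective _ ⟨h, surjective_restrictTrace hd M⟩).finrank_eq
    rw [this, Module.finrank_fintype_fun_eq_card, Fintype.card_coe]
  · intro h
    exact (LinearMap.injective_iff_surjective_of_finrank_eq_finrank (by
      rw [← h, Module.finrank_fintype_fun_eq_card, Fintype.card_coe])).2
      (surjective_restrictTrace hd M)

end Sauer

end ConceptClass

namespace ConceptClass

/-! ### From tight traces on `(d + 2)`-sets to the whole family -/

section LocalToGlobal

variable {α : Type*} [DecidableEq α] {𝒜 : Finset (Finset α)} {d : ℕ} {f : Finset α → Finset α}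

/-- The indicator of the family of sets having trace `f S` on `S` and containing `T \ S`. -/
def extIndicator (f : Finset α → Finset α) (S T : Finset α) : Finset α → ZMod 2 :=
  monomial (T \ S) * traceIndicator S (f S)

theorem extIndicator_self (S : Finset α) : extIndicator f S S = traceIndicator S (f S) := by
  have h1 : monomial (S \ S) = (1 : Finset α → ZMod 2) := by
    funext Z; simp [monomial]
  rw [extIndicator, h1, one_mul]

theorem monomial_mul_extIndicator {R S T : Finset α} (hR : Disjoint R S) :
    monomial R * extIndicator f S T = extIndicator f S (R ∪ T) := by
  rw [extIndicator, extIndicator, ← mul_assoc, monomial_mul, Finset.union_sdiff_distrib,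
    Finset.sdiff_eq_self_of_disjoint hR]

/-- `f` picks for every `(d + 1)`-set a trace which no member of `𝒜` has. -/
def IsForbidden (𝒜 : Finset (Finset α)) (d : ℕ) (f : Finset α → Finset α) : Prop :=
  ∀ S : Finset α, S.card = d + 1 → f S ⊆ S ∧ ∀ A ∈ 𝒜, A ∩ S ≠ f S

theorem exists_isForbidden (hd : 𝒜.vcDim ≤ d) : ∃ f, IsForbidden 𝒜 d f := by
  have h : ∀ S : Finset α, ∃ X, S.card = d + 1 → X ⊆ S ∧ ∀ A ∈ 𝒜, A ∩ S ≠ X := fun S => by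
    by_cases hS : S.card = d + 1
    · obtain ⟨X, hX⟩ := exists_forbidden hd hS
      exact ⟨X, fun _ => hX⟩
    · exact ⟨∅, fun h => absurd h hS⟩
  choose f hf using h
  exact ⟨f, hf⟩

theorem IsForbidden.extIndicator_mem_vanishing (hf : IsForbidden 𝒜 d f) {S : Finset α}
    (hS : S.card = d + 1) (T : Finset α) : extIndicator f S T ∈ vanishing 𝒜 :=
  mul_mem_vanishing _ (traceIndicator_mem_vanishing (hf S hS).2)

theorem IsForbidden.lowDegree_succ_le (hf : IsForbidden 𝒜 d f) (W : Finset α) :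
    lowDegree (d + 1) W ≤
      Submodule.span (ZMod 2) {p | ∃ U ⊆ W, U.card = d + 1 ∧ extIndicator f U U = p} ⊔
        lowDegree d W := by
  refine Submodule.span_le.2 ?_
  rintro _ ⟨V, ⟨hV, hVc⟩, rfl⟩
  rcases Nat.lt_or_ge d V.card with hlt | hle
  · have hVd : V.card = d + 1 := by omega
    have h1 := traceIndicator_sub_mem (hf V hVd).1 hVd
    have h2 : extIndicator f V V ∈
        Submodule.span (ZMod 2) {p | ∃ U ⊆ W, U.card = d + 1 ∧ extIndicator f U U = p} :=
      Submodule.subset_span ⟨V, hV, hVd, rfl⟩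
    rw [extIndicator_self] at h2
    simpa using Submodule.sub_mem _ (Submodule.mem_sup_left h2)
      (Submodule.mem_sup_right (lowDegree_mono le_rfl hV h1))
  · exact Submodule.mem_sup_right (monomial_mem_lowDegree hV hle)

/-- The relations between forbidden traces on a set of `d + 2` coordinates. -/
theorem IsForbidden.sub_mem_of_card_eq (hf : IsForbidden 𝒜 d f) {S S' W : Finset α}
    (hW : W.card = d + 2) (hI : IndepOn 𝒜 d W) (hS : S ⊆ W) (hS' : S' ⊆ W)
    (hSc : S.card = d + 1) (hSc' : S'.card = d + 1) :
    extIndicator f S W - extIndicator f S' W ∈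
      Submodule.span (ZMod 2) {p | ∃ U ⊆ W, U.card = d + 1 ∧ extIndicator f U U = p} := by
  -- Both products lead with `monomial W`, so their difference has degree at most `d + 1`. Modulo
  -- indicators it drops to degree `d`, where independence kills the vanishing remainder `q`.
  have h1 := monomial_mul_traceIndicator_sub_mem (hf S hSc).1 hS hW
  have h2 := monomial_mul_traceIndicator_sub_mem (hf S' hSc').1 hS' hW
  have h3 := hf.lowDegree_succ_le W (Submodule.sub_mem _ h1 h2)
  rw [sub_sub_sub_cancel_right] at h3
  obtain ⟨p, hp, q, hq, hpq⟩ := Submodule.mem_sup.1 h3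
  have hpv : p ∈ vanishing 𝒜 := by
    refine Submodule.span_le.2 ?_ hp
    rintro _ ⟨U, _, hU, rfl⟩
    exact hf.extIndicator_mem_vanishing hU U
  have hqv : q ∈ vanishing 𝒜 := by
    have h4 := Submodule.sub_mem _ (Submodule.sub_mem _ (hf.extIndicator_mem_vanishing hSc W)
      (hf.extIndicator_mem_vanishing hSc' W)) hpv
    rwa [extIndicator, extIndicator, ← hpq, add_sub_cancel_left] at h4
  rw [hI q hq hqv, add_zero] at hpq
  rw [extIndicator, extIndicator, ← hpq]
  exact hp

/-- The span of the indicators extended to sets with fewer than `t` elements. -/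
def extSpan (f : Finset α → Finset α) (d t : ℕ) : Submodule (ZMod 2) (Finset α → ZMod 2) :=
  Submodule.span (ZMod 2)
    {p | ∃ U T : Finset α, U ⊆ T ∧ U.card = d + 1 ∧ T.card < t ∧ extIndicator f U T = p}

/-- Multiply the relation on `W` by `monomial (T \ W)`: each term `U` on the right is extended to `T
\ W ∪ U`, which is smaller than `T`. -/
theorem IsForbidden.sub_mem_extSpan_of_subset (hf : IsForbidden 𝒜 d f) {S S' W T : Finset α}
    (hW : W.card = d + 2) (hI : IndepOn 𝒜 d W) (hS : S ⊆ W) (hS' : S' ⊆ W)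
    (hSc : S.card = d + 1) (hSc' : S'.card = d + 1) (hT : W ⊆ T) :
    extIndicator f S T - extIndicator f S' T ∈ extSpan f d T.card := by
  have hdisj : ∀ U ⊆ W, Disjoint (T \ W) U := fun U hU =>
    Finset.disjoint_of_subset_right hU Finset.sdiff_disjoint
  have h := Submodule.mem_map_of_mem (f := LinearMap.mulLeft (ZMod 2) (monomial (T \ W)))
    (hf.sub_mem_of_card_eq hW hI hS hS' hSc hSc')
  rw [LinearMap.mulLeft_apply, mul_sub, monomial_mul_extIndicator (hdisj S hS),
    monomial_mul_extIndicator (hdisj S' hS'), Finset.sdiff_union_of_subset hT] at h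
  refine Submodule.map_span_le _ _ _ |>.2 ?_ h
  rintro _ ⟨U, hU, hUc, rfl⟩
  rw [LinearMap.mulLeft_apply, monomial_mul_extIndicator (hdisj U hU)]
  refine Submodule.subset_span ⟨U, T \ W ∪ U, Finset.subset_union_right, hUc, ?_, rfl⟩
  have h1 := Finset.card_union_le (T \ W) U
  have h2 := Finset.card_sdiff_add_card_eq_card hT
  omega

/-- Walk from `S` to `S'` by single exchanges; consecutive sets lie in a common `(d + 2)`-set. -/
theorem IsForbidden.sub_mem_extSpan (hf : IsForbidden 𝒜 d f)
    (hI : ∀ W : Finset α, W.card = d + 2 → IndepOn 𝒜 d W) {S S' T : Finset α}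
    (hS : S ⊆ T) (hS' : S' ⊆ T) (hSc : S.card = d + 1) (hSc' : S'.card = d + 1) :
    extIndicator f S T - extIndicator f S' T ∈ extSpan f d T.card := by
  induction hn : (S \ S').card generalizing S with
  | zero =>
    have hsub : S ⊆ S' := by rwa [Finset.card_eq_zero, Finset.sdiff_eq_empty_iff_subset] at hn
    rw [Finset.eq_of_subset_of_card_le hsub (by omega), sub_self]
    exact Submodule.zero_mem _
  | succ n ih =>
    have hn' : (S' \ S).card = n + 1 := by
      rw [← hn]
      exact Finset.card_sdiff_comm (by omega)
    obtain ⟨a, ha⟩ := Finset.card_pos.1 (show 0 < (S \ S').card by omega)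
    obtain ⟨b, hb⟩ := Finset.card_pos.1 (show 0 < (S' \ S).card by omega)
    rw [Finset.mem_sdiff] at ha hb
    have hbe : b ∉ S.erase a := fun h => hb.2 (Finset.mem_of_mem_erase h)
    have hSb : insert b (S.erase a) ⊆ insert b S :=
      Finset.insert_subset_insert _ (Finset.erase_subset _ _)
    have hSbT : insert b S ⊆ T := Finset.insert_subset (hS' hb.1) hS
    have hc : (insert b (S.erase a)).card = d + 1 := by
      rw [Finset.card_insert_of_notMem hbe, Finset.card_erase_of_mem ha.1]
      omega
    have hW : (insert b S).card = d + 2 := by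
      rw [Finset.card_insert_of_notMem hb.2]
      omega
    have h1 := hf.sub_mem_extSpan_of_subset hW (hI _ hW) (Finset.subset_insert b S) hSb hSc hc hSbT
    have h2 := ih (hSb.trans hSbT) hc (by
      rw [Finset.insert_sdiff_of_mem _ hb.1, Finset.erase_sdiff_comm,
        Finset.card_erase_of_mem (Finset.mem_sdiff.2 ha), hn]
      rfl)
    simpa using Submodule.add_mem _ h1 h2

/-- One extended indicator for each set with more than `d` elements spans all of them. -/
theorem IsForbidden.extIndicator_mem_span (hf : IsForbidden 𝒜 d f)
    (hI : ∀ W : Finset α, W.card = d + 2 → IndepOn 𝒜 d W) {g : Finset α → Finset α}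
    (hg : ∀ T : Finset α, d < T.card → g T ⊆ T ∧ (g T).card = d + 1) {S T : Finset α}
    (hS : S ⊆ T) (hSc : S.card = d + 1) :
    extIndicator f S T ∈ Submodule.span (ZMod 2)
      (Set.range fun T : {T : Finset α // d < T.card} => extIndicator f (g T) T) := by
  induction hn : T.card using Nat.strong_induction_on generalizing S T with
  | _ n ih =>
    have hT : d < T.card := by
      have := Finset.card_le_card hS
      omega
    have h1 := hf.sub_mem_extSpan hI hS (hg T hT).1 hSc (hg T hT).2
    have h2 : extIndicator f (g T) T ∈ Submodule.span (ZMod 2)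
        (Set.range fun T : {T : Finset α // d < T.card} => extIndicator f (g T) T) :=
      Submodule.subset_span ⟨⟨T, hT⟩, rfl⟩
    refine (Submodule.sub_mem_iff_left _ h2).1 (Submodule.span_le.2 ?_ h1)
    rintro _ ⟨U, T', hU, hUc, hT', rfl⟩
    exact ih T'.card (by omega) hU hUc rfl

/-- Forbidden traces on `(d + 1)`-sets are unique. -/
theorem IsForbidden.eq_of_forall_ne (hf : IsForbidden 𝒜 d f) {S X : Finset α}
    (hI : IndepOn 𝒜 d S) (hS : S.card = d + 1) (hX : X ⊆ S) (hforb : ∀ A ∈ 𝒜, A ∩ S ≠ X) :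
    X = f S := by
  -- The two indicators share their leading monomial, so their difference is a vanishing function of
  -- degree at most `d`.
  have h1 := Submodule.sub_mem _ (traceIndicator_sub_mem hX hS)
    (traceIndicator_sub_mem (hf S hS).1 hS)
  rw [sub_sub_sub_cancel_right] at h1
  have h2 := congrFun (hI _ h1 (Submodule.sub_mem _ (traceIndicator_mem_vanishing hforb)
    (traceIndicator_mem_vanishing (hf S hS).2))) X
  by_contra hne
  simp [traceIndicator, Finset.inter_eq_left.2 hX, hne] at h2

theorem monomial_mul_traceIndicator (B S X : Finset α) :
    monomial B * traceIndicator S X =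
      if B ∩ S ⊆ X then monomial (B \ S) * traceIndicator S X else 0 := by
  have h : monomial B = monomial (B \ S) * monomial (B ∩ S) := by
    rw [monomial_mul, Finset.sdiff_union_inter]
  rw [h, mul_assoc]
  have h' : monomial (B ∩ S) * traceIndicator S X =
      if B ∩ S ⊆ X then traceIndicator S X else 0 := by
    funext Z
    by_cases hZ : Z ∩ S = X
    · subst hZ
      have : B ∩ S ⊆ Z ↔ B ∩ S ⊆ Z ∩ S := by
        simp [Finset.subset_inter_iff]
      split_ifs with hB <;> simp [monomial, this, hB]
    · split_ifs <;> simp [traceIndicator, hZ]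
  rw [h']
  split_ifs <;> simp

/-- The point mass at `X` is unchanged by multiplication with the indicator on `S`; expanded in
monomials, each product is zero or an extended indicator. -/
theorem single_mem_of_extIndicator_mem [Fintype α] {S X : Finset α} (hS : X ∩ S = f S)
    {G : Submodule (ZMod 2) (Finset α → ZMod 2)}
    (hG : ∀ T, S ⊆ T → extIndicator f S T ∈ G) : Pi.single X (1 : ZMod 2) ∈ G := by
  have h : Pi.single X (1 : ZMod 2) = Pi.single X (1 : ZMod 2) * traceIndicator S (f S) := by
    funext Z
    by_cases hZ : Z = X
    · subst hZ; simp [traceIndicator, hS]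
    · simp [hZ]
  rw [h, ← traceIndicator_univ, ← sum_Icc_monomial, Finset.sum_mul]
  refine Submodule.sum_mem _ fun B _ => ?_
  rw [monomial_mul_traceIndicator]
  split_ifs
  · have := hG (B ∪ S) Finset.subset_union_right
    rwa [extIndicator, Finset.union_sdiff_right] at this
  · exact Submodule.zero_mem _

/-- A family cut out by forbidding traces on `(d + 1)`-sets, whose traces on all `(d + 2)`-sets meet
the Sauer–Shelah bound, meets that bound itself. -/
theorem le_card_of_indepOn [Fintype α] (hd : 𝒜.vcDim ≤ d) (hα : d + 2 ≤ Fintype.card α)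
    (hI : ∀ W : Finset α, W.card = d + 2 → IndepOn 𝒜 d W)
    (hmax : ∀ X ∉ 𝒜, ∃ S : Finset α, S.card = d + 1 ∧ ∀ A ∈ 𝒜, A ∩ S ≠ X ∩ S) :
    (Finset.univ.filter fun T : Finset α => T.card ≤ d).card ≤ 𝒜.card := by
  obtain ⟨f, hf⟩ := exists_isForbidden hd
  have hg : ∀ T : Finset α, ∃ S, d < T.card → S ⊆ T ∧ S.card = d + 1 := fun T => by
    by_cases hT : d < T.card
    · obtain ⟨S, hS⟩ := Finset.exists_subset_card_eq (Nat.succ_le_of_lt hT)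
      exact ⟨S, fun _ => hS⟩
    · exact ⟨∅, fun h => absurd h hT⟩
  choose g hg using hg
  set G := Submodule.span (ZMod 2)
    (Set.range fun T : {T : Finset α // d < T.card} => extIndicator f (g T) T) with hG
  have hsingle : ∀ X ∈ 𝒜ᶜ, Pi.single X (1 : ZMod 2) ∈ G := fun X hX => by
    obtain ⟨S, hS, hforb⟩ := hmax X (Finset.mem_compl.1 hX)
    obtain ⟨W, hSW, hW⟩ := Finset.exists_superset_card_eq (s := S) (n := d + 2) (by omega) hα
    have hXS := hf.eq_of_forall_ne ((hI W hW).mono hSW) hS Finset.inter_subset_right hforb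
    exact single_mem_of_extIndicator_mem hXS fun T hT => hf.extIndicator_mem_span hI hg hT hS
  have hlin : LinearIndependent (ZMod 2)
      (fun X : (𝒜ᶜ : Finset (Finset α)) => (Pi.single X.1 1 : Finset α → ZMod 2)) := by
    have := (Pi.basisFun (ZMod 2) (Finset α)).linearIndependent.comp
      (Subtype.val : (𝒜ᶜ : Finset (Finset α)) → Finset α) Subtype.val_injective
    convert this using 1
    funext X
    simp
  have h1 := finrank_span_eq_card hlin
  have h2 : Submodule.span (ZMod 2) (Set.range
      fun X : (𝒜ᶜ : Finset (Finset α)) => (Pi.single X.1 1 : Finset α → ZMod 2)) ≤ G := by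
    refine Submodule.span_le.2 ?_
    rintro _ ⟨X, rfl⟩
    exact hsingle X.1 X.2
  have h3 := Submodule.finrank_mono h2
  have h4 : Module.finrank (ZMod 2) G ≤ _ := finrank_range_le_card (R := ZMod 2)
    fun T : {T : Finset α // d < T.card} => extIndicator f (g T) T
  rw [h1, Fintype.card_coe, Finset.card_compl] at h3
  rw [Fintype.card_subtype] at h4
  have h5 := Finset.card_filter_add_card_filter_not (s := (Finset.univ : Finset (Finset α)))
    (fun T => T.card ≤ d)
  simp only [not_le, Finset.card_univ] at h5
  have h6 := Finset.card_le_univ 𝒜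
  omega

end LocalToGlobal

end ConceptClass

namespace ConceptClass

/-! ### Cubes, missed patterns and maximality -/

section Concepts

variable {n : ℕ}

theorem mem_support {c : Fin n → Bool} {i : Fin n} : i ∈ support c ↔ c i = true := by
  simp [support]

theorem support_injective : Function.Injective (support : (Fin n → Bool) → Finset (Fin n)) := by
  intro a b h
  funext i
  rw [Bool.eq_iff_iff, ← mem_support, ← mem_support, h]

theorem vcDim_image_support_le (C : Finset (Fin n → Bool)) : (C.image support).vcDim ≤ vcDim C :=
  le_rfl

theorem support_decide_mem (X : Finset (Fin n)) : support (fun i => decide (i ∈ X)) = X := by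
  ext i
  simp [mem_support]

theorem support_inter_eq_iff {x a : Fin n → Bool} {M : Finset (Fin n)} :
    support x ∩ M = support a ∩ M ↔ ∀ i ∈ M, x i = a i := by
  simp only [Finset.ext_iff, Finset.mem_inter, mem_support]
  refine forall_congr' fun i => ?_
  rw [show x i = a i ↔ (x i = true ↔ a i = true) from Bool.eq_iff_iff]
  tauto

/-- The cube with free coordinates `I` whose other coordinates are given by `X`. -/
def cube (I X : Finset (Fin n)) : Finset (Fin n → Bool) :=
  Finset.univ.filter fun x => support x ∩ Iᶜ = X

theorem mem_cube {I X : Finset (Fin n)} {x : Fin n → Bool} :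
    x ∈ cube I X ↔ support x ∩ Iᶜ = X := by
  simp [cube]

theorem isCube_iff {k : ℕ} {Q : Finset (Fin n → Bool)} :
    IsCube k Q ↔ ∃ I X : Finset (Fin n), I.card = k ∧ X ⊆ Iᶜ ∧ cube I X = Q := by
  have key : ∀ (I : Finset (Fin n)) (a : Fin n → Bool), cube I (support a ∩ Iᶜ) =
      Finset.univ.filter fun x => ∀ i, i ∉ I → x i = a i := fun I a => by
    ext x
    simp [mem_cube, support_inter_eq_iff]
  constructor
  · rintro ⟨I, a, hI, rfl⟩
    exact ⟨I, support a ∩ Iᶜ, hI, Finset.inter_subset_right, key I a⟩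
  · rintro ⟨I, X, hI, hX, rfl⟩
    refine ⟨I, fun i => decide (i ∈ X), hI, ?_⟩
    rw [← key, support_decide_mem, Finset.inter_eq_left.2 hX]

theorem eq_of_cube_subset {I J X Y : Finset (Fin n)} (hX : X ⊆ Iᶜ) (h : cube I X ⊆ cube J Y) :
    I ⊆ J ∧ X ∩ Jᶜ = Y := by
  have hmem : ∀ Z : Finset (Fin n), Z ∩ Iᶜ = X → Z ∩ Jᶜ = Y := fun Z hZ => by
    have := h (mem_cube.2 (by rwa [support_decide_mem Z]))
    rwa [mem_cube, support_decide_mem] at this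
  have h1 := hmem X (Finset.inter_eq_left.2 hX)
  refine ⟨fun i hi => ?_, h1⟩
  by_contra hiJ
  -- Flipping the free coordinate `i` stays in the first cube but would change the pattern on `Jᶜ`.
  have h2 := hmem (insert i X) (by
    rw [Finset.insert_inter_of_notMem (by simpa using hi), Finset.inter_eq_left.2 hX])
  rw [Finset.insert_inter_of_mem (by simpa using hiJ), ← h1] at h2
  have h3 : i ∈ X ∩ Jᶜ := h2 ▸ Finset.mem_insert_self _ _
  exact Finset.mem_compl.1 (hX (Finset.mem_inter.1 h3).1) hi

theorem cube_injective {I J X Y : Finset (Fin n)} (hX : X ⊆ Iᶜ) (hY : Y ⊆ Jᶜ)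
    (h : cube I X = cube J Y) : I = J ∧ X = Y := by
  obtain ⟨h1, h2⟩ := eq_of_cube_subset hX h.subset
  have h3 := (eq_of_cube_subset hY h.superset).1
  obtain rfl := h1.antisymm h3
  exact ⟨rfl, by rw [← h2, Finset.inter_eq_left.2 hX]⟩

/-- The `k`-cubes in the complement of `C` with free coordinates `I` correspond to the patterns
on `Iᶜ` that `C` misses. -/
theorem cubeCount_compl (k : ℕ) (C : Finset (Fin n → Bool)) :
    cubeCount k Cᶜ = ∑ I ∈ Finset.powersetCard k Finset.univ,
      (2 ^ (n - k) - ((C.image support).image (· ∩ Iᶜ)).card) := by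
  classical
  have hcard : ∀ I ∈ Finset.powersetCard k (Finset.univ : Finset (Fin n)),
      2 ^ (n - k) - ((C.image support).image (· ∩ Iᶜ)).card =
        (Iᶜ.powerset \ (C.image support).image (· ∩ Iᶜ)).card := fun I hI => by
    have hsub : (C.image support).image (· ∩ Iᶜ) ⊆ Iᶜ.powerset := fun X hX => by
      obtain ⟨A, _, rfl⟩ := Finset.mem_image.1 hX
      exact Finset.mem_powerset.2 Finset.inter_subset_right
    rw [Finset.card_sdiff_of_subset hsub, Finset.card_powerset, Finset.card_compl,
      (Finset.mem_powersetCard.1 hI).2, Fintype.card_fin]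
  rw [Finset.sum_congr rfl hcard, ← Finset.card_sigma, cubeCount]
  symm
  refine Finset.card_nbij (fun p => cube p.1 p.2) ?_ ?_ ?_
  · rintro ⟨I, X⟩ hp
    simp only [Finset.mem_coe, Finset.mem_sigma, Finset.mem_powersetCard, Finset.mem_sdiff,
      Finset.mem_powerset] at hp
    refine Finset.mem_filter.2 ⟨Finset.mem_powerset.2 fun x hx => ?_,
      isCube_iff.2 ⟨I, X, hp.1.2, hp.2.1, rfl⟩⟩
    rw [Finset.mem_compl]
    exact fun hxC => hp.2.2 (Finset.mem_image.2
      ⟨support x, Finset.mem_image_of_mem _ hxC, mem_cube.1 hx⟩)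
  · rintro ⟨I, X⟩ hp ⟨J, Y⟩ hq h
    simp only [Finset.mem_coe, Finset.mem_sigma, Finset.mem_sdiff,
      Finset.mem_powerset] at hp hq
    obtain ⟨rfl, rfl⟩ := cube_injective hp.2.1 hq.2.1 h
    rfl
  · intro Q hQ
    obtain ⟨hQC, hQ⟩ := Finset.mem_filter.1 (Finset.mem_coe.1 hQ)
    obtain ⟨I, X, hI, hX, rfl⟩ := isCube_iff.1 hQ
    refine ⟨⟨I, X⟩, ?_, rfl⟩
    simp only [Finset.mem_coe, Finset.mem_sigma, Finset.mem_powersetCard, Finset.mem_sdiff,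
      Finset.mem_powerset]
    refine ⟨⟨Finset.subset_univ _, hI⟩, hX, fun hmem => ?_⟩
    obtain ⟨A, hA, hAX⟩ := Finset.mem_image.1 hmem
    obtain ⟨c, hc, rfl⟩ := Finset.mem_image.1 hA
    exact Finset.mem_compl.1 (Finset.mem_powerset.1 hQC (mem_cube.2 hAX)) hc

/-- A maximal class is cut out by forbidden traces on sets of size one more than its
VC dimension. -/
theorem IsMaximal.exists_forbidden {C : Finset (Fin n → Bool)} (hC : IsMaximal C)
    {X : Finset (Fin n)} (hX : X ∉ C.image support) :
    ∃ S : Finset (Fin n), S.card = vcDim C + 1 ∧ ∀ A ∈ C.image support, A ∩ S ≠ X ∩ S := by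
  have hx : (fun i => decide (i ∈ X)) ∉ C := fun h =>
    hX (Finset.mem_image.2 ⟨_, h, support_decide_mem X⟩)
  have h1 := hC _ (Finset.ssubset_insert hx)
  rw [vcDim, vcDim, Finset.image_insert, support_decide_mem] at h1
  obtain ⟨T, hT, hTc⟩ := Finset.lt_sup_iff.1 h1
  obtain ⟨S, hST, hS⟩ := Finset.exists_subset_card_eq (Nat.succ_le_of_lt hTc)
  have hsh := (Finset.mem_shatterer.1 hT).mono_right hST
  refine ⟨S, hS, fun B hB hBX => ?_⟩
  -- If a member `B` has the trace of `X` on `S`, it replaces `X` as a witness, so `C` alone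
  -- shatters too large a set.
  have hsh' : (C.image support).Shatters S := fun t ht => by
    obtain ⟨u, hu, hut⟩ := hsh ht
    rcases Finset.mem_insert.1 hu with rfl | hu
    · exact ⟨B, hB, by rw [Finset.inter_comm, hBX, Finset.inter_comm, hut]⟩
    · exact ⟨u, hu, hut⟩
  have h2 := hsh'.card_le_vcDim
  omega

theorem isMaximum_iff_indepOn {C : Finset (Fin n → Bool)} :
    IsMaximum C ↔ IndepOn (C.image support) (vcDim C) Finset.univ := by
  rw [indepOn_iff_card (vcDim_image_support_le C), card_powerset_filter_card_le, IsMaximum]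
  simp [Finset.card_image_of_injective _ support_injective]

/-- A maximal class is maximum iff its restrictions to all sets of `m` coordinates are, for a fixed
`m` exceeding the VC dimension by at least two. -/
theorem IsMaximal.isMaximum_iff {C : Finset (Fin n → Bool)} (hC : IsMaximal C) {m : ℕ}
    (hm : vcDim C + 2 ≤ m) (hmn : m ≤ n) :
    IsMaximum C ↔ ∀ M : Finset (Fin n), M.card = m →
      IndepOn (C.image support) (vcDim C) M := by
  constructor
  · exact fun h M _ => (isMaximum_iff_indepOn.1 h).mono (Finset.subset_univ M)
  · intro h
    have h1 := le_card_of_indepOn (𝒜 := C.image support) (d := vcDim C) le_rfl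
      (by simpa using hm.trans hmn) (fun W hW => by
        obtain ⟨M, hWM, hM⟩ := Finset.exists_superset_card_eq (s := W) (n := m) (by omega)
          (by simpa using hmn)
        exact (h M hM).mono hWM) fun X hX => hC.exists_forbidden hX
    rw [isMaximum_iff_indepOn, indepOn_iff_card (vcDim_image_support_le C)]
    refine (card_image_inter_le (vcDim_image_support_le C) _).antisymm ?_
    simpa using h1

end Concepts

/-- The right side is the form Sauer–Shelah gives: a choice of `I`, then the fewest missed patterns.
The tail sum is reflected by `i ↦ n - i`. -/
theorem sum_Icc_choose_mul_choose {n d k : ℕ} (hk : k + d + 1 < n) :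
    ∑ i ∈ Finset.Icc k (n - d - 1), i.choose k * n.choose i =
      n.choose k * (2 ^ (n - k) - ∑ i ∈ Finset.Icc 0 d, (n - k).choose i) := by
  have h1 : ∑ i ∈ Finset.Icc k (n - d - 1), i.choose k * n.choose i =
      ∑ i ∈ Finset.Icc k (n - d - 1), n.choose k * (n - k).choose (i - k) :=
    Finset.sum_congr rfl fun i hi => by
      rw [mul_comm, Nat.choose_mul (Finset.mem_Icc.1 hi).1]
  have h2 : ∑ i ∈ Finset.Icc k (n - d - 1), (n - k).choose (i - k) =
      ∑ j ∈ Finset.Icc (d + 1) (n - k), (n - k).choose j := by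
    refine Finset.sum_nbij' (fun i => n - i) (fun j => n - j) ?_ ?_ ?_ ?_ ?_
    · intro i hi; simp only [Finset.mem_Icc] at *; omega
    · intro i hi; simp only [Finset.mem_Icc] at *; omega
    · intro i hi; simp only [Finset.mem_Icc] at *; omega
    · intro i hi; simp only [Finset.mem_Icc] at *; omega
    · intro i hi
      rw [Finset.mem_Icc] at hi
      rw [← Nat.choose_symm (show i - k ≤ n - k by omega)]
      congr 1
      omega
  have h3 : ∑ i ∈ Finset.Icc 0 d, (n - k).choose i +
      ∑ j ∈ Finset.Icc (d + 1) (n - k), (n - k).choose j = 2 ^ (n - k) := by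
    rw [← Nat.sum_range_choose, ← Finset.sum_union]
    · congr 1
      ext j
      simp only [Finset.mem_union, Finset.mem_Icc, Finset.mem_range]
      omega
    · rw [Finset.disjoint_left]
      intro j
      simp only [Finset.mem_Icc]
      omega
  rw [h1, ← Finset.mul_sum, h2, ← h3, Nat.add_sub_cancel_left]

end ConceptClass

/-! ### The cube count and its equality case -/

theorem theorem2 (n d k : ℕ) (hk : k + d + 1 < n)
    (C : Finset (Fin n → Bool)) (hd : ConceptClass.vcDim C = d)
    (hC : ConceptClass.IsMaximal C) :
    (∑ i ∈ Finset.Icc k (n - d - 1), i.choose k * n.choose i) ≤ ConceptClass.cubeCount k Cᶜ ∧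
    (ConceptClass.cubeCount k Cᶜ = (∑ i ∈ Finset.Icc k (n - d - 1), i.choose k * n.choose i) ↔
      ConceptClass.IsMaximum C) := by
  subst hd
  set d := ConceptClass.vcDim C with hd
  set 𝒜 := C.image ConceptClass.support with h𝒜
  set N := ∑ i ∈ Finset.Icc 0 d, (n - k).choose i with hN
  have hIc : ∀ I ∈ Finset.powersetCard k (Finset.univ : Finset (Fin n)), Iᶜ.card = n - k :=
    fun I hI => by
      rw [Finset.card_compl, (Finset.mem_powersetCard.1 hI).2, Fintype.card_fin]
  have hle : ∀ I ∈ Finset.powersetCard k (Finset.univ : Finset (Fin n)),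
      (𝒜.image (· ∩ Iᶜ)).card ≤ N := fun I hI => by
    have := ConceptClass.card_image_inter_le (𝒜 := 𝒜) (d := d) le_rfl Iᶜ
    rwa [ConceptClass.card_powerset_filter_card_le, hIc I hI] at this
  have hN2 : N ≤ 2 ^ (n - k) := by
    rw [← Nat.sum_range_choose]
    refine Finset.sum_le_sum_of_subset fun i hi => ?_
    rw [Finset.mem_Icc] at hi
    rw [Finset.mem_range]
    omega
  have hsum : ∑ i ∈ Finset.Icc k (n - d - 1), i.choose k * n.choose i =
      ∑ I ∈ Finset.powersetCard k (Finset.univ : Finset (Fin n)), (2 ^ (n - k) - N) := by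
    rw [ConceptClass.sum_Icc_choose_mul_choose hk]
    rw [Finset.sum_const, Finset.card_powersetCard, Finset.card_univ, Fintype.card_fin, smul_eq_mul]
  have hle' : ∀ I ∈ Finset.powersetCard k (Finset.univ : Finset (Fin n)),
      2 ^ (n - k) - N ≤ 2 ^ (n - k) - (𝒜.image (· ∩ Iᶜ)).card := fun I hI =>
    Nat.sub_le_sub_left (hle I hI) _
  rw [hsum, ConceptClass.cubeCount_compl]
  refine ⟨Finset.sum_le_sum hle', ?_⟩
  rw [eq_comm, Finset.sum_eq_sum_iff_of_le hle',
    -- The strict bound on `k` is exactly `d + 2 ≤ n - k`.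
    hC.isMaximum_iff (m := n - k) (by omega) (by omega)]
  have hiff : ∀ I ∈ Finset.powersetCard k (Finset.univ : Finset (Fin n)),
      (2 ^ (n - k) - N = 2 ^ (n - k) - (𝒜.image (· ∩ Iᶜ)).card ↔
        ConceptClass.IndepOn 𝒜 d Iᶜ) := fun I hI => by
    rw [ConceptClass.indepOn_iff_card (𝒜 := 𝒜) (ConceptClass.vcDim_image_support_le C), ConceptClass.card_powerset_filter_card_le,
      hIc I hI, ← hN]
    -- With `hN2` neither truncated subtraction loses information, so equal differences force equal
    -- cardinalities.
    have := hle I hI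
    omega
  constructor
  · intro h M hM
    have hI : Mᶜ ∈ Finset.powersetCard k (Finset.univ : Finset (Fin n)) := by
      rw [Finset.mem_powersetCard, Finset.card_compl, hM, Fintype.card_fin]
      exact ⟨Finset.subset_univ _, by omega⟩
    have := (hiff _ hI).1 (h _ hI)
    rwa [compl_compl] at this
  · exact fun h I hI => (hiff I hI).2 (h Iᶜ (hIc I hI))
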